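/- Let $\alpha>-1$ and, for $t\ge 0$, let $w(x;t)=x^{\alpha}\mathrm e^{-x-t/x}$ for $x\in(0,\infty)$, with moments $\mu_j(t)=\int_0^\infty x^j w(x;t)\,dx$, $j=0,1,2,\ldots$. Let $P_n(x;t)$, $n=0,1,2,\ldots$, be the monic polynomials orthogonal with respect to $w(\cdot;t)$ on $(0,\infty)$, with $P_n$ of degree $n$, and write $P_n(x;t)=x^n+\mathrm p(n,t)\,x^{n-1}+\cdots$, so that $\mathrm p(n,t)$ is the sub-leading coefficient of $P_n$ (and $\mathrm p(0,t)=0$). Let $D_n(t)=\det\big(\mu_{i+j}(t)\big)_{i,j=0}^{n-1}$ be the Hankel determinant, with $D_0(t)=1$. Theorem. Fix $n\in\{0,1,2,\ldots\}$ and $\alpha>-1$. For every $t>0$ we have $D_n(t)>0$ and $\ln D_n$ is differentiable at $t$; put $H_n(t)=t\,\frac{d}{dt}\ln D_n(t)$. Then, as $t\to+\infty$, $$\mathrm p(n,t)=-n\sqrt t-\frac{n(2\alpha+3n)}{4}-\frac{n\left[4(\alpha+n)^2-1\right]}{32\sqrt t}+O(t^{-1}),$$ $$H_n(t)=-n\sqrt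 t+\frac{n(2\alpha+n)}{4}-\frac{n\left[4(\alpha+n)^2-1\right]}{32\sqrt t}+O(t^{-1}),$$ where the constants implied by $O(t^{-1})$ may depend on $n$ and $\alpha$. -/

import Mathlib

open Filter Asymptotics Set MeasureTheory Polynomial

namespace SingularLaguerre

noncomputable section

/-- The singularly perturbed Laguerre weight `w(x; t, α) = x ^ α * exp (-x - t / x)` on `x > 0`. -/
def weight (α t x : ℝ) : ℝ := x ^ α * Real.exp (-x - t / x)

/-- The `j`-th moment of the weight over `(0, ∞)`. -/
def moment (α t : ℝ) (j : ℕ) : ℝ := ∫ x in Ioi (0 : ℝ), x ^ j * weight α t x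

/-- The Hankel determinant `det (μ_{i+j})_{i,j=0}^{n-1}`; it equals `1` for `n = 0`. -/
def hankelDet (α : ℝ) (n : ℕ) (t : ℝ) : ℝ :=
  (Matrix.of fun i j : Fin n => moment α t (i.val + j.val)).det

/-- `H_n(t) = t * d/dt (ln D_n(t))`. -/
def logDerivHankel (α : ℝ) (n : ℕ) (t : ℝ) : ℝ :=
  t * deriv (fun s => Real.log (hankelDet α n s)) t

/-- The pairing `∫_0^∞ p(x) q(x) w(x; t, α) dx` of two polynomials. -/
def pairing (α t : ℝ) (p q : ℝ[X]) : ℝ :=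
  ∫ x in Ioi (0 : ℝ), p.eval x * q.eval x * weight α t x

/-- `P 0, P 1, P 2, …` is the sequence of monic polynomials, `P n` of degree `n`, orthogonal with
respect to the weight, with positive squared norms `h_n`. -/
structure IsMonicOrthogonal (α t : ℝ) (P : ℕ → ℝ[X]) : Prop where
  monic : ∀ n, (P n).Monic
  natDegree : ∀ n, (P n).natDegree = n
  orthogonal : ∀ j k, j ≠ k → pairing α t (P j) (P k) = 0
  norm_pos : ∀ n, 0 < pairing α t (P n) (P n)

/-- The monic orthogonal polynomials for the weight, constructed by Gram–Schmidt from
`1, x, x ^ 2, …`. They are characterised by `isMonicOrthogonal_iff` below. -/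
def monicOP (α t : ℝ) (n : ℕ) : ℝ[X] :=
  X ^ n - ∑ k : Fin n,
    C (pairing α t (X ^ n) (monicOP α t k.val) /
      pairing α t (monicOP α t k.val) (monicOP α t k.val)) * monicOP α t k.val
termination_by n
decreasing_by exact k.isLt

/-- The sub-leading coefficient `p(n, t)`: the coefficient of `x ^ (n - 1)` in the monic orthogonal
polynomial of degree `n`, and `0` for `n = 0`. -/
def subleading (α : ℝ) (n : ℕ) (t : ℝ) : ℝ :=
  match n with
  | 0 => 0
  | m + 1 => (monicOP α t (m + 1)).coeff m

theorem weight_pos (α t : ℝ) {x : ℝ} (hx : 0 < x) : 0 < weight α t x :=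
  mul_pos (Real.rpow_pos_of_pos hx α) (Real.exp_pos _)

theorem integrableOn_moment {α t : ℝ} (hα : -1 < α) (ht : 0 ≤ t) (j : ℕ) :
    IntegrableOn (fun x => x ^ j * weight α t x) (Ioi 0) := by
  have hs : (0 : ℝ) < j + α + 1 := by
    have : (0 : ℝ) ≤ j := Nat.cast_nonneg j
    linarith
  refine Integrable.mono' (Real.GammaIntegral_convergent hs) ?_ ?_
  · unfold weight
    exact Measurable.aestronglyMeasurable (by fun_prop)
  · refine (ae_restrict_iff' measurableSet_Ioi).2 (Eventually.of_forall fun x hx => ?_)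
    have hx : 0 < x := hx
    rw [Real.norm_of_nonneg (mul_nonneg (pow_nonneg hx.le _) (weight_pos α t hx).le)]
    have h1 : x ^ ((j : ℝ) + α + 1 - 1) = x ^ j * x ^ α := by
      rw [add_sub_cancel_right, Real.rpow_add hx, Real.rpow_natCast]
    rw [h1, weight, mul_comm (Real.exp (-x)), mul_assoc]
    have h2 : Real.exp (-x - t / x) ≤ Real.exp (-x) :=
      Real.exp_le_exp.2 (by linarith [div_nonneg ht hx.le])
    have h3 := (Real.rpow_pos_of_pos hx α).le
    gcongr

theorem integrableOn_poly {α t : ℝ} (hα : -1 < α) (ht : 0 ≤ t) (p : ℝ[X]) :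
    IntegrableOn (fun x => p.eval x * weight α t x) (Ioi 0) := by
  induction p using Polynomial.induction_on' with
  | add p q hp hq =>
    simp only [eval_add, add_mul]
    exact hp.add hq
  | monomial n a =>
    simp only [eval_monomial, mul_assoc]
    exact (integrableOn_moment hα ht n).const_mul a

theorem pairing_comm (α t : ℝ) (p q : ℝ[X]) : pairing α t p q = pairing α t q p := by
  simp only [pairing, mul_comm (p.eval _)]

theorem pairing_sub {α t : ℝ} (hα : -1 < α) (ht : 0 ≤ t) (p q r : ℝ[X]) :
    pairing α t (p - q) r = pairing α t p r - pairing α t q r := by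
  unfold pairing
  simp only [← eval_mul]
  rw [← integral_sub (integrableOn_poly hα ht _) (integrableOn_poly hα ht _)]
  simp only [sub_mul, eval_sub]

theorem pairing_C_mul (α t c : ℝ) (p r : ℝ[X]) :
    pairing α t (C c * p) r = c * pairing α t p r := by
  unfold pairing
  rw [← integral_const_mul]
  simp only [eval_mul, eval_C, mul_assoc]

theorem pairing_sum {α t : ℝ} (hα : -1 < α) (ht : 0 ≤ t) {ι : Type} (s : Finset ι)
    (f : ι → ℝ[X]) (r : ℝ[X]) :
    pairing α t (∑ i ∈ s, f i) r = ∑ i ∈ s, pairing α t (f i) r := by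
  unfold pairing
  simp only [← eval_mul]
  rw [← integral_finsetSum _ fun i _ => integrableOn_poly hα ht _]
  simp only [Finset.sum_mul, eval_finsetSum]

theorem pairing_self_pos {α t : ℝ} (hα : -1 < α) (ht : 0 ≤ t) {p : ℝ[X]} (hp : p ≠ 0) :
    0 < pairing α t p p := by
  unfold pairing
  have hint := integrableOn_poly hα ht (p * p)
  simp only [eval_mul] at hint
  rw [setIntegral_pos_iff_support_of_nonneg_ae _ hint]
  · have hsub : Ioi (0 : ℝ) \ (p.roots.toFinset : Set ℝ) ⊆
        Function.support (fun x => p.eval x * p.eval x * weight α t x) ∩ Ioi 0 := by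
      rintro x ⟨hx, hr⟩
      have hx0 : p.eval x ≠ 0 := fun h => hr (by simpa [hp] using h)
      exact ⟨mul_ne_zero (mul_ne_zero hx0 hx0) (weight_pos α t hx).ne', hx⟩
    refine lt_of_lt_of_le ?_ (measure_mono hsub)
    rw [measure_sdiff_null (p.roots.toFinset.finite_toSet.measure_zero volume)]
    simp
  · refine (ae_restrict_iff' measurableSet_Ioi).2 (Eventually.of_forall fun x hx => ?_)
    exact mul_nonneg (mul_self_nonneg _) (weight_pos α t hx).le

theorem monicOP_monic_degree (α t : ℝ) (n : ℕ) :
    (monicOP α t n).Monic ∧ (monicOP α t n).degree = n := by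
  induction n using Nat.strong_induction_on with
  | _ n ih =>
    have h : (∑ k : Fin n,
        C (pairing α t (X ^ n) (monicOP α t k.val) /
          pairing α t (monicOP α t k.val) (monicOP α t k.val)) *
            monicOP α t k.val).degree < n := by
      refine lt_of_le_of_lt (degree_sum_le _ _) ?_
      refine (Finset.sup_lt_iff (WithBot.bot_lt_coe n)).2 fun k _ => ?_
      rw [← smul_eq_C_mul]
      refine lt_of_le_of_lt (degree_smul_le _ _) ?_
      rw [(ih k.val k.isLt).2]
      exact Nat.cast_lt.2 k.isLt
    rw [monicOP]
    refine ⟨monic_X_pow_sub (p := _) (n := n) h, ?_⟩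
    rw [degree_sub_eq_left_of_degree_lt (by rwa [degree_X_pow]), degree_X_pow]

theorem monicOP_orthogonal_lt {α t : ℝ} (hα : -1 < α) (ht : 0 ≤ t) (n : ℕ) :
    ∀ j < n, pairing α t (monicOP α t n) (monicOP α t j) = 0 := by
  induction n using Nat.strong_induction_on with
  | _ n ih =>
    intro j hj
    have hpos := pairing_self_pos hα ht (monicOP_monic_degree α t j).1.ne_zero
    rw [monicOP, pairing_sub hα ht, pairing_sum hα ht,
      Finset.sum_eq_single (⟨j, hj⟩ : Fin n)]
    · rw [pairing_C_mul, div_mul_cancel₀ _ hpos.ne', sub_self]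
    · intro k _ hk
      rw [pairing_C_mul]
      have hne : k.val ≠ j := fun h => hk (Fin.ext h)
      rcases lt_or_gt_of_ne hne with h | h
      · rw [pairing_comm α t (monicOP α t k.val) (monicOP α t j), ih j hj k.val h, mul_zero]
      · rw [ih k.val k.isLt j h, mul_zero]
    · simp

theorem monicOP_isMonicOrthogonal {α t : ℝ} (hα : -1 < α) (ht : 0 ≤ t) :
    IsMonicOrthogonal α t (monicOP α t) where
  monic n := (monicOP_monic_degree α t n).1
  natDegree n := natDegree_eq_of_degree_eq_some (monicOP_monic_degree α t n).2
  orthogonal j k hjk := by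
    rcases lt_or_gt_of_ne hjk with h | h
    · rw [pairing_comm, monicOP_orthogonal_lt hα ht k j h]
    · exact monicOP_orthogonal_lt hα ht j k h
  norm_pos n := pairing_self_pos hα ht (monicOP_monic_degree α t n).1.ne_zero

/-- A polynomial orthogonal to `P 0, …, P (n - 1)` is orthogonal to every polynomial of degree
less than `n`. -/
theorem pairing_eq_zero_of_degree_lt {α t : ℝ} (hα : -1 < α) (ht : 0 ≤ t) {P : ℕ → ℝ[X]}
    (hP : IsMonicOrthogonal α t P) {r : ℝ[X]} {n : ℕ}
    (hr : ∀ k < n, pairing α t (P k) r = 0) (q : ℝ[X]) (hq : q.degree < n) :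
    pairing α t q r = 0 := by
  induction n generalizing q with
  | zero =>
    have : q = 0 := by simpa using hq
    simp [this, pairing]
  | succ m ih =>
    have hPm : (P m).degree = m := by
      rw [degree_eq_natDegree (hP.monic m).ne_zero, hP.natDegree]
    have key : pairing α t (q - C (q.coeff m) * P m) r = 0 := by
      refine ih (fun k hk => hr k (by omega)) _ ?_
      rw [degree_lt_iff_coeff_zero]
      intro i hi
      rcases eq_or_lt_of_le hi with h | h
      · subst h
        have h1 : (P m).coeff m = 1 := by
          have := (hP.monic m).coeff_natDegree
          rwa [hP.natDegree] at this
        simp [h1]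
      · have h1 : q.coeff i = 0 :=
          coeff_eq_zero_of_degree_lt (lt_of_lt_of_le hq (by exact_mod_cast h))
        have h2 : (P m).coeff i = 0 :=
          coeff_eq_zero_of_degree_lt (by rw [hPm]; exact_mod_cast h)
        simp [h1, h2]
    rw [pairing_sub hα ht, pairing_C_mul, hr m (Nat.lt_succ_self m), mul_zero, sub_zero] at key
    exact key

/-- `monicOP` is the one and only sequence of monic orthogonal polynomials for the weight. -/
theorem isMonicOrthogonal_iff {α t : ℝ} (hα : -1 < α) (ht : 0 ≤ t) (P : ℕ → ℝ[X]) :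
    IsMonicOrthogonal α t P ↔ P = monicOP α t := by
  refine ⟨fun hP => ?_, fun h => h ▸ monicOP_isMonicOrthogonal hα ht⟩
  have hQ := monicOP_isMonicOrthogonal hα ht
  funext n
  have hPn : (P n).degree = n := by
    rw [degree_eq_natDegree (hP.monic n).ne_zero, hP.natDegree]
  have hd : (P n - monicOP α t n).degree < n := by
    rw [← hPn]
    refine degree_sub_lt_left ?_ (hP.monic n).ne_zero ?_
    · rw [hPn, (monicOP_monic_degree α t n).2]
    · rw [(hP.monic n).leadingCoeff, (hQ.monic n).leadingCoeff]
  by_contra hne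
  have hpos := pairing_self_pos hα ht (sub_ne_zero.2 hne)
  have h1 := pairing_eq_zero_of_degree_lt hα ht hP
    (fun k hk => hP.orthogonal k n hk.ne) _ hd
  have h2 := pairing_eq_zero_of_degree_lt hα ht hQ
    (fun k hk => hQ.orthogonal k n hk.ne) _ hd
  rw [pairing_comm, pairing_sub hα ht, pairing_comm α t (P n),
    pairing_comm α t (monicOP α t n), h1, h2] at hpos
  simp at hpos

end

end SingularLaguerre

/-! Write `p n` for the sub-leading coefficient, `h n` for the squared norm and `β n = h n / h
(n-1)`. Differentiating the orthogonality relations in `t` produces integrals against the weight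
with exponent `α - 1`, and integration by parts in `x` turns `t` times such an integral back into
data at `α`. The result is a Toda-type system (`hasDerivAt_subleading`, `hasDerivAt_sqNorm`): `t
p_n' = p_n + β_n` and `t β_n' = β_n (p_{n+1} - 2 p_n + p_{n-1} + 2)`.

Read from left to right, the system gives `p_{n+1}` from `p_n` and `p_{n-1}`, so the expansion
follows by induction on `n` (`isSymbol_toda`). Each step differentiates twice, and a bare `O(t⁻¹)`
does not survive that. The induction is therefore run with remainders all of whose Euler derivatives
`(t d/dt)^j` are `O(t⁻¹)` (`IsSymbol`).

For `n = 1` the system closes into the Riccati equation `t p' = -(1+α) p + t - p²`. Two positivity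
arguments give `p 1 = -√t + O(1)`. Subtracting the three-term ansatz leaves a remainder with `t r' =
b r + g`, `b ~ 2√t`, `g = O(t^(-1/2))`. Nonzero homogeneous solutions of such an equation grow
faster than any power, so a polynomially bounded solution has size `g / b`, that is `O(t⁻¹)`
(`isBigO_of_linear_ode`, `isSymbol_riccati`).

Finally `D_n = ∏ h_k`, and the logarithmic derivatives of the `h_k` telescope to `H_n = p n + n (n +
α)`, so both expansions are the same statement. -/

namespace SingularLaguerre

/-! ### Symbol classes: asymptotic bounds stable under `t d/dt`. -/

/-- `IsSymbol k m f`: the functions `(t * d/dt)^j f`, `j ≤ k`, exist for large `t` and are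
`O(t ^ m)` as `t → ∞`. -/
def IsSymbol : ℕ → ℝ → (ℝ → ℝ) → Prop
  | 0, m, f => f =O[atTop] fun t : ℝ => t ^ m
  | k + 1, m, f => (f =O[atTop] fun t : ℝ => t ^ m) ∧
      ∃ g : ℝ → ℝ, (∀ᶠ t in atTop, HasDerivAt f (g t / t) t) ∧ IsSymbol k m g

namespace IsSymbol

variable {k : ℕ} {m l : ℝ} {f g : ℝ → ℝ}

theorem isBigO (h : IsSymbol k m f) : f =O[atTop] fun t : ℝ => t ^ m := by
  cases k with
  | zero => exact h
  | succ k => exact h.1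

theorem of_succ (h : IsSymbol (k + 1) m f) : IsSymbol k m f := by
  induction k generalizing f with
  | zero => exact h.1
  | succ k ih =>
    obtain ⟨h0, g, hg, hs⟩ := h
    exact ⟨h0, g, hg, ih hs⟩

theorem congr (h : IsSymbol k m f) (hfg : f =ᶠ[atTop] g) : IsSymbol k m g := by
  cases k with
  | zero => exact IsBigO.congr' h hfg EventuallyEq.rfl
  | succ k =>
    obtain ⟨h0, f', hf', hs⟩ := h
    refine ⟨h0.congr' hfg EventuallyEq.rfl, f', ?_, hs⟩
    obtain ⟨T, hT⟩ := eventually_atTop.1 hfg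
    filter_upwards [hf', eventually_gt_atTop T] with t ht htT
    refine ht.congr_of_eventuallyEq ?_
    filter_upwards [lt_mem_nhds htT] with s hs
    exact (hT s hs.le).symm

/-- By uniqueness of derivatives the existential witness in `IsSymbol` is eventually equal to any
other Euler derivative. This is the tool for differentiating an asymptotic expansion. -/
theorem euler (h : IsSymbol (k + 1) m f) (hg : ∀ᶠ t in atTop, HasDerivAt f (g t / t) t) :
    IsSymbol k m g := by
  obtain ⟨-, g', hg', hs⟩ := h
  refine hs.congr ?_
  filter_upwards [hg, hg', eventually_gt_atTop 0] with t h1 h2 h3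
  have := h2.unique h1
  field_simp at this
  exact this

theorem mono (h : IsSymbol k m f) (hml : m ≤ l) : IsSymbol k l f := by
  have key : (fun t : ℝ => t ^ m) =O[atTop] fun t : ℝ => t ^ l := by
    refine IsBigO.of_bound 1 ?_
    filter_upwards [eventually_ge_atTop 1] with t ht
    have h0 : (0 : ℝ) ≤ t := by linarith
    rw [Real.norm_of_nonneg (Real.rpow_nonneg h0 _), Real.norm_of_nonneg (Real.rpow_nonneg h0 _),
      one_mul]
    exact Real.rpow_le_rpow_of_exponent_le ht hml
  induction k generalizing f with
  | zero => exact IsBigO.trans h key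
  | succ k ih =>
    obtain ⟨h0, g, hg, hs⟩ := h
    exact ⟨h0.trans key, g, hg, ih hs⟩

theorem add (hf : IsSymbol k m f) (hg : IsSymbol k m g) : IsSymbol k m fun t => f t + g t := by
  induction k generalizing f g with
  | zero => exact IsBigO.add hf hg
  | succ k ih =>
    obtain ⟨hf0, f', hf', hfs⟩ := hf
    obtain ⟨hg0, g', hg', hgs⟩ := hg
    refine ⟨hf0.add hg0, fun t => f' t + g' t, ?_, ih hfs hgs⟩
    filter_upwards [hf', hg'] with t h1 h2
    rw [add_div]
    exact h1.add h2

theorem const_mul (c : ℝ) (hf : IsSymbol k m f) : IsSymbol k m fun t => c * f t := by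
  induction k generalizing f with
  | zero => exact IsBigO.const_mul_left hf c
  | succ k ih =>
    obtain ⟨hf0, f', hf', hfs⟩ := hf
    refine ⟨hf0.const_mul_left c, fun t => c * f' t, ?_, ih hfs⟩
    filter_upwards [hf'] with t h1
    rw [mul_div_assoc]
    exact h1.const_mul c

theorem neg (hf : IsSymbol k m f) : IsSymbol k m fun t => -f t := by
  simpa using hf.const_mul (-1)

theorem sub (hf : IsSymbol k m f) (hg : IsSymbol k m g) : IsSymbol k m fun t => f t - g t := by
  simpa only [sub_eq_add_neg] using hf.add hg.neg

theorem mul (hf : IsSymbol k m f) (hg : IsSymbol k l g) :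
    IsSymbol k (m + l) fun t => f t * g t := by
  have key : ∀ {f g : ℝ → ℝ}, (f =O[atTop] fun t : ℝ => t ^ m) →
      (g =O[atTop] fun t : ℝ => t ^ l) →
      (fun t => f t * g t) =O[atTop] fun t : ℝ => t ^ (m + l) := by
    intro f g hf hg
    refine (hf.mul hg).congr' EventuallyEq.rfl ?_
    filter_upwards [eventually_gt_atTop 0] with t ht
    rw [Real.rpow_add ht]
  induction k generalizing f g with
  | zero => exact key hf hg
  | succ k ih =>
    have hfk := hf.of_succ
    have hgk := hg.of_succ
    obtain ⟨hf0, f', hf', hfs⟩ := hf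
    obtain ⟨hg0, g', hg', hgs⟩ := hg
    refine ⟨key hf0 hg0, fun t => f' t * g t + f t * g' t, ?_, (ih hfs hgk).add (ih hfk hgs)⟩
    filter_upwards [hf', hg'] with t h1 h2
    exact (h1.mul h2).congr_deriv (by ring)

theorem rpow (k : ℕ) (m : ℝ) : IsSymbol k m fun t => t ^ m := by
  induction k with
  | zero => exact isBigO_refl _ _
  | succ k ih =>
    refine ⟨isBigO_refl _ _, fun t => m * t ^ m, ?_, ih.const_mul m⟩
    filter_upwards [eventually_gt_atTop 0] with t ht
    have := Real.hasDerivAt_rpow_const (p := m) (Or.inl ht.ne')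
    rwa [Real.rpow_sub_one ht.ne', ← mul_div_assoc] at this

theorem const (k : ℕ) (c : ℝ) : IsSymbol k 0 fun _ => c := by
  refine ((rpow k 0).const_mul c).congr ?_
  exact Eventually.of_forall fun t => by simp

/-- The lower bound `hm` is needed only at order zero: the Euler derivative of `1/f` is `-f' / f²`,
with `f'` the Euler derivative of `f`, so the higher orders follow from the product rule. -/
theorem inv (hf : IsSymbol k m f) (hm : (fun t : ℝ => t ^ m) =O[atTop] f) :
    IsSymbol k (-m) fun t => (f t)⁻¹ := by
  have h0 : ∀ᶠ t in atTop, f t ≠ 0 := by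
    obtain ⟨C, hC⟩ := hm.bound
    filter_upwards [hC, eventually_gt_atTop 0] with t h1 h2 h3
    rw [h3, norm_zero, mul_zero, norm_le_zero_iff] at h1
    exact (Real.rpow_pos_of_pos h2 m).ne' h1
  have key : (fun t => (f t)⁻¹) =O[atTop] fun t : ℝ => t ^ (-m) := by
    refine (hm.inv_rev ?_).congr' EventuallyEq.rfl ?_
    · filter_upwards [eventually_gt_atTop 0] with t h2 h3
      exact absurd h3 (Real.rpow_pos_of_pos h2 m).ne'
    · filter_upwards [eventually_gt_atTop 0] with t h2
      rw [Real.rpow_neg h2.le]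
  induction k with
  | zero => exact key
  | succ k ih =>
    have hi := ih hf.of_succ
    obtain ⟨-, f', hf', hfs⟩ := hf
    refine ⟨key, fun t => -(f' t * ((f t)⁻¹ * (f t)⁻¹)), ?_, ?_⟩
    · filter_upwards [hf', h0] with t h1 h2
      refine (h1.inv h2).congr_deriv ?_
      field_simp
    · have := (hfs.mul (hi.mul hi)).neg
      rwa [show m + (-m + -m) = -m by ring] at this

end IsSymbol

/-! ### Polynomially bounded solutions of `t v' = b v + G`. -/

/-- One-sided growth barrier: a solution of `t * v' = b * v + G` with `b` at least of order `√t`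
which grows at most polynomially cannot exceed a multiple of `1 / t`. -/
theorem le_of_linear_ode {v b G : ℝ → ℝ} {c C K M : ℝ} (hc : 0 < c) (hC : 0 ≤ C)
    (hb : ∀ᶠ t : ℝ in atTop, c * t ^ (1 / 2 : ℝ) ≤ b t)
    (hG : ∀ᶠ t : ℝ in atTop, -(C * t ^ (-1 / 2 : ℝ)) ≤ G t)
    (hv : ∀ᶠ t : ℝ in atTop, v t ≤ K * t ^ M)
    (hd : ∀ᶠ t in atTop, HasDerivAt v ((b t * v t + G t) / t) t) :
    ∀ᶠ t in atTop, v t ≤ C / c * t⁻¹ := by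
  have hlarge : ∀ᶠ t : ℝ in atTop, M + 1 < c * t ^ (1 / 2 : ℝ) :=
    ((tendsto_rpow_atTop (by norm_num)).const_mul_atTop hc).eventually_gt_atTop _
  obtain ⟨T, hT⟩ := eventually_atTop.1
    (hb.and (hG.and (hv.and (hd.and (hlarge.and (eventually_gt_atTop 0))))))
  filter_upwards [eventually_ge_atTop T] with t₀ ht₀
  by_contra! hlt
  set A := C / c with hA
  have hA0 : 0 ≤ A := by positivity
  -- `A / t` is a barrier because `b * A / t ≥ C t^(-1/2)` outweighs `-G`. The factor `t^(-(M+1))`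
  -- makes `y ≤ K / t`, so `y` cannot stay above a positive constant. The loss `M + 1` it causes in
  -- the derivative is beaten by `b` once `t` is large (`hlarge`).
  let y : ℝ → ℝ := fun t => (v t - A * t⁻¹) * t ^ (-(M + 1))
  let y' : ℝ → ℝ := fun t =>
    ((b t * v t + G t) / t - A * -(t ^ 2)⁻¹) * t ^ (-(M + 1)) +
      (v t - A * t⁻¹) * (-(M + 1) * t ^ (-(M + 1) - 1))
  have hy : ∀ t, T ≤ t → HasDerivAt y (y' t) t := by
    intro t ht
    obtain ⟨-, -, -, h4, -, h6⟩ := hT t ht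
    exact (h4.sub ((hasDerivAt_inv h6.ne').const_mul A)).mul
      (Real.hasDerivAt_rpow_const (Or.inl h6.ne'))
  have hypos : ∀ t, T ≤ t → 0 < y t → 0 < y' t := by
    intro t ht hyt
    obtain ⟨h1, h2, -, -, h5, h6⟩ := hT t ht
    have hu : 0 < v t - A * t⁻¹ := pos_of_mul_pos_left hyt (Real.rpow_nonneg h6.le _)
    have hp := Real.rpow_pos_of_pos h6 (-(M + 1))
    have hs : t ^ (1 / 2 : ℝ) * t⁻¹ = t ^ (-1 / 2 : ℝ) := by
      rw [← Real.rpow_neg_one, ← Real.rpow_add h6]; norm_num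
    have e : y' t = t ^ (-(M + 1)) * t⁻¹ *
        ((b t - (M + 1)) * (v t - A * t⁻¹) + ((b t * (A * t⁻¹) + G t) + A * t⁻¹)) := by
      simp only [y', Real.rpow_sub_one h6.ne']
      field_simp
      ring
    have h7 : C * t ^ (-1 / 2 : ℝ) ≤ b t * (A * t⁻¹) := by
      calc C * t ^ (-1 / 2 : ℝ) = (c * t ^ (1 / 2 : ℝ)) * (A * t⁻¹) := by
            rw [← hs, hA]; field_simp
        _ ≤ _ := by gcongr
    have h8 : 0 < (b t - (M + 1)) * (v t - A * t⁻¹) := mul_pos (by linarith) hu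
    have h9 : 0 ≤ A * t⁻¹ := by positivity
    rw [e]
    exact mul_pos (mul_pos hp (inv_pos.2 h6)) (by linarith)
  have hT0 := (hT t₀ ht₀).2.2.2.2.2
  have hy0 : 0 < y t₀ := mul_pos (by linarith) (Real.rpow_pos_of_pos hT0 _)
  have hmono : ∀ t, t₀ ≤ t → y t₀ ≤ y t := by
    intro t ht
    -- The comparison with the constant `y t₀` tests the derivative only at points where `y s = y t₀
    -- > 0`, exactly where `hypos` applies.
    have := image_le_of_deriv_right_lt_deriv_boundary (f := fun s => -y s) (f' := fun s => -y' s)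
      (a := t₀) (b := t) (B := fun _ => -y t₀) (B' := fun _ => 0)
      (fun s hs => (hy s (ht₀.trans hs.1)).continuousAt.continuousWithinAt.neg)
      (fun s hs => (hy s (ht₀.trans hs.1)).neg.hasDerivWithinAt) le_rfl
      (fun s => hasDerivAt_const s _)
      (fun s hs he => by
        have h1 := hypos s (ht₀.trans hs.1) (by
          rw [neg_inj.1 he]; exact hy0)
        simpa using h1) (right_mem_Icc.2 ht)
    simpa using this
  have hlim : Tendsto (fun t : ℝ => K * t⁻¹) atTop (nhds 0) := by
    simpa using tendsto_inv_atTop_zero.const_mul K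
  obtain ⟨t, h1, h2⟩ := ((hlim.eventually_lt_const hy0).and (eventually_ge_atTop t₀)).exists
  obtain ⟨-, -, h3, -, -, h6⟩ := hT t (ht₀.trans h2)
  have h4 : y t ≤ K * t ^ M * t ^ (-(M + 1)) := by
    have : 0 ≤ A * t⁻¹ := by positivity
    refine mul_le_mul_of_nonneg_right (by linarith) (Real.rpow_nonneg h6.le _)
  have h5 : K * t ^ M * t ^ (-(M + 1)) = K * t⁻¹ := by
    rw [mul_assoc, ← Real.rpow_add h6, ← Real.rpow_neg_one]; ring_nf
  linarith [hmono t h2]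

theorem isBigO_of_linear_ode {v b G : ℝ → ℝ} {c M : ℝ} (hc : 0 < c)
    (hb : ∀ᶠ t : ℝ in atTop, c * t ^ (1 / 2 : ℝ) ≤ b t)
    (hG : G =O[atTop] fun t : ℝ => t ^ (-1 / 2 : ℝ))
    (hv : v =O[atTop] fun t : ℝ => t ^ M)
    (hd : ∀ᶠ t in atTop, HasDerivAt v ((b t * v t + G t) / t) t) :
    v =O[atTop] fun t : ℝ => t ^ (-1 : ℝ) := by
  obtain ⟨C, hC, hGC⟩ := hG.exists_nonneg
  obtain ⟨K, hvK⟩ := hv.bound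
  have hGC := hGC.bound
  have hpos : ∀ᶠ t : ℝ in atTop, 0 < t := eventually_gt_atTop 0
  have hG' : ∀ᶠ t : ℝ in atTop, |G t| ≤ C * t ^ (-1 / 2 : ℝ) := by
    filter_upwards [hGC, hpos] with t h1 h2
    rwa [Real.norm_eq_abs, Real.norm_of_nonneg (Real.rpow_nonneg h2.le _)] at h1
  have hv' : ∀ᶠ t : ℝ in atTop, |v t| ≤ K * t ^ M := by
    filter_upwards [hvK, hpos] with t h1 h2
    rwa [Real.norm_eq_abs, Real.norm_of_nonneg (Real.rpow_nonneg h2.le _)] at h1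
  have h1 := le_of_linear_ode hc hC hb (hG'.mono fun t h => neg_le_of_abs_le h)
    (hv'.mono fun t h => le_of_abs_le h) hd
  have h2 := le_of_linear_ode (v := fun t => -v t) (G := fun t => -G t) hc hC hb
    (hG'.mono fun t h => neg_le_neg (le_of_abs_le h))
    (hv'.mono fun t h => neg_le.1 (neg_le_of_abs_le h))
    (hd.mono fun t h => h.neg.congr_deriv (by ring))
  refine IsBigO.of_bound (C / c) ?_
  filter_upwards [h1, h2, hpos] with t h1 h2 h3
  rw [Real.rpow_neg_one, Real.norm_of_nonneg (inv_nonneg.2 h3.le)]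
  exact abs_le.2 ⟨by linarith, h1⟩

/-- The Euler derivative `w = b v + G` solves the same equation with inhomogeneity `(t b') v + t
G'`, which is again of order `-1/2`. The order-zero bound can thus be applied repeatedly. -/
theorem IsSymbol.of_linear_ode {k : ℕ} {v b G : ℝ → ℝ} {c M : ℝ} (hc : 0 < c)
    (hb : IsSymbol k (1 / 2) b) (hbc : ∀ᶠ t : ℝ in atTop, c * t ^ (1 / 2 : ℝ) ≤ b t)
    (hG : IsSymbol k (-1 / 2) G) (hv : v =O[atTop] fun t : ℝ => t ^ M)
    (hd : ∀ᶠ t in atTop, HasDerivAt v ((b t * v t + G t) / t) t) :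
    IsSymbol k (-1) v := by
  induction k generalizing v G M with
  | zero => exact isBigO_of_linear_ode hc hbc hG hv hd
  | succ k ih =>
    have h0 := isBigO_of_linear_ode hc hbc hG.isBigO hv hd
    have hvk := ih hb.of_succ hG.of_succ hv hd
    refine ⟨h0, fun t => b t * v t + G t, hd, ?_⟩
    have hwO := ((hb.of_succ.mul hvk).add ((hG.of_succ).mono (by norm_num))).isBigO
    have hbk := hb.of_succ
    obtain ⟨-, b', hb', hbs⟩ := hb
    obtain ⟨-, G', hG', hGs⟩ := hG
    refine ih (G := fun t => b' t * v t + G' t) hbk ?_ hwO ?_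
    · exact ((hbs.mul hvk).mono (by norm_num)).add hGs
    · filter_upwards [hd, hb', hG'] with t h1 h2 h3
      exact ((h2.mul h1).add h3).congr_deriv (by ring)

theorem IsSymbol.eventually_abs_le {k : ℕ} {m l ε : ℝ} {f : ℝ → ℝ} (hf : IsSymbol k m f)
    (hml : m < l) (hε : 0 < ε) : ∀ᶠ t in atTop, |f t| ≤ ε * t ^ l := by
  obtain ⟨C, hC⟩ := hf.isBigO.bound
  have h1 : Tendsto (fun t : ℝ => ε * t ^ (l - m)) atTop atTop :=
    (tendsto_rpow_atTop (by linarith)).const_mul_atTop hε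
  filter_upwards [hC, h1.eventually_ge_atTop C, eventually_gt_atTop 0] with t h2 h3 h4
  rw [Real.norm_eq_abs, Real.norm_of_nonneg (Real.rpow_nonneg h4.le _)] at h2
  calc |f t| ≤ C * t ^ m := h2
    _ ≤ ε * t ^ (l - m) * t ^ m := by gcongr
    _ = ε * t ^ l := by rw [mul_assoc, ← Real.rpow_add h4]; ring_nf

/-! ### Three-term expansions, the Riccati equation and the Toda recursion. -/

/-- The function `-N √t - A - c / √t`. -/
noncomputable def threeTerm (N A c t : ℝ) : ℝ := -N * t ^ (1 / 2 : ℝ) - A - c * t ^ (-1 / 2 : ℝ)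

theorem hasDerivAt_rpow_div (m : ℝ) {t : ℝ} (ht : 0 < t) :
    HasDerivAt (fun t : ℝ => t ^ m) (m * t ^ m / t) t :=
  (Real.hasDerivAt_rpow_const (Or.inl ht.ne')).congr_deriv
    (by rw [Real.rpow_sub_one ht.ne', mul_div_assoc])

theorem hasDerivAt_threeTerm (N A c : ℝ) {t : ℝ} (ht : 0 < t) :
    HasDerivAt (threeTerm N A c)
      ((-(N / 2) * t ^ (1 / 2 : ℝ) + c / 2 * t ^ (-1 / 2 : ℝ)) / t) t :=
  ((((hasDerivAt_rpow_div (1 / 2) ht).const_mul (-N)).sub_const A).sub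
    ((hasDerivAt_rpow_div (-1 / 2) ht).const_mul c)).congr_deriv (by ring)

theorem isSymbol_threeTerm (k : ℕ) (N A c : ℝ) : IsSymbol k (1 / 2) (threeTerm N A c) :=
  (((IsSymbol.rpow k (1 / 2)).const_mul (-N)).sub
    ((IsSymbol.const k A).mono (by norm_num))).sub
      (((IsSymbol.rpow k (-1 / 2)).mono (by norm_num)).const_mul c)

theorem rpow_half_mul_rpow_neg_half {t : ℝ} (ht : 0 < t) :
    t ^ (1 / 2 : ℝ) * t ^ (-1 / 2 : ℝ) = 1 := by
  rw [← Real.rpow_add ht]; norm_num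

theorem rpow_half_mul_self {t : ℝ} (ht : 0 < t) : t ^ (1 / 2 : ℝ) * t ^ (1 / 2 : ℝ) = t := by
  rw [← Real.rpow_add ht]; norm_num

/-- If `p` has a three-term expansion, `t p' = p + β` and `t β' = β σ`, then `σ` has an explicit
two-term expansion. -/
theorem isSymbol_logDeriv_of_threeTerm {N A c : ℝ} (hN : 0 < N) {p β σ : ℝ → ℝ}
    (hp : ∀ k, IsSymbol k (-1) fun t => p t - threeTerm N A c t)
    (hdp : ∀ t, 0 < t → HasDerivAt p ((p t + β t) / t) t)
    (hdβ : ∀ t, 0 < t → HasDerivAt β (β t * σ t / t) t) (k : ℕ) :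
    IsSymbol k (-1) fun t => σ t - 1 / 2 + A / N * t ^ (-1 / 2 : ℝ) := by
  have hpos : ∀ᶠ t : ℝ in atTop, 0 < t := eventually_gt_atTop 0
  have hr' : ∀ k, IsSymbol k (-1) fun t =>
      p t + β t - (-(N / 2) * t ^ (1 / 2 : ℝ) + c / 2 * t ^ (-1 / 2 : ℝ)) := by
    intro k
    refine (hp (k + 1)).euler ?_
    filter_upwards [hpos] with t ht
    exact ((hdp t ht).sub (hasDerivAt_threeTerm N A c ht)).congr_deriv (by ring)
  have hq : ∀ k, IsSymbol k (-1 / 2) fun t => β t - (N / 2 * t ^ (1 / 2 : ℝ) + A) := by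
    intro k
    refine ((((hr' k).sub (hp k)).mono (by norm_num)).add
      ((IsSymbol.rpow k (-1 / 2)).const_mul (3 / 2 * c))).congr ?_
    exact Eventually.of_forall fun t => by simp only [threeTerm]; ring
  have hq' : IsSymbol k (-1 / 2) fun t => β t * σ t - N / 4 * t ^ (1 / 2 : ℝ) := by
    refine (hq (k + 1)).euler ?_
    filter_upwards [hpos] with t ht
    exact ((hdβ t ht).sub (((hasDerivAt_rpow_div (1 / 2) ht).const_mul (N / 2)).add_const
      A)).congr_deriv (by ring)
  have hlow : IsSymbol k 0 fun t => β t - N / 2 * t ^ (1 / 2 : ℝ) :=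
    (((hq k).mono (by norm_num)).add (IsSymbol.const k A)).congr
      (Eventually.of_forall fun t => by ring)
  have hβ : IsSymbol k (1 / 2) β :=
    ((hlow.mono (by norm_num)).add ((IsSymbol.rpow k (1 / 2)).const_mul (N / 2))).congr
      (Eventually.of_forall fun t => by ring)
  have hβlow : ∀ᶠ t : ℝ in atTop, N / 4 * t ^ (1 / 2 : ℝ) ≤ β t := by
    filter_upwards [hlow.eventually_abs_le (l := 1 / 2) (by norm_num) (ε := N / 4) (by positivity)]
      with t ht
    linarith [neg_le_of_abs_le ht]
  have hinv := hβ.inv (IsBigO.of_bound (4 / N) (by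
    filter_upwards [hβlow, hpos] with t h1 h2
    rw [Real.norm_of_nonneg (Real.rpow_nonneg h2.le _)]
    calc t ^ (1 / 2 : ℝ) = 4 / N * (N / 4 * t ^ (1 / 2 : ℝ)) := by field_simp
      _ ≤ 4 / N * ‖β t‖ := by
        gcongr
        exact h1.trans (Real.le_norm_self _)))
  -- This is `β (σ - 1/2 + (A/N) t^(-1/2))`, expanded with `β = (N/2) √t + A + O(t^(-1/2))` and `β σ
  -- = (N/4) √t + O(t^(-1/2))`. The terms of order `√t` and `1` cancel, and dividing by `β` gains
  -- another `t^(-1/2)`. The coefficient `c` affects only the error.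
  have hX := (((hq'.sub ((hq k).const_mul (1 / 2))).add
    ((IsSymbol.rpow k (-1 / 2)).const_mul (A ^ 2 / N))).add
      ((((hq k).mul (IsSymbol.rpow k (-1 / 2))).const_mul (A / N)).mono (by norm_num)))
  refine ((hinv.mul hX).mono (by norm_num)).congr ?_
  filter_upwards [hβlow, hpos] with t h1 h2
  have h3 : 0 < β t := lt_of_lt_of_le (mul_pos (by positivity) (Real.rpow_pos_of_pos h2 _)) h1
  have h4 := rpow_half_mul_rpow_neg_half h2
  rw [inv_mul_eq_iff_eq_mul₀ h3.ne']
  have h5 : A / N * N = A := by field_simp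
  have h6 : A ^ 2 / N = A / N * A := by ring
  rw [h6]
  linear_combination (-(A / N) * N / 2) * h4 - h5 / 2

/-- Solutions of the Riccati equation `t p' = -(1 + α) p + t - p²` with `p = -√t + O(1)`. -/
theorem isSymbol_riccati {α : ℝ} {p : ℝ → ℝ}
    (hp : IsSymbol 0 0 fun t => p t + t ^ (1 / 2 : ℝ))
    (hd : ∀ t, 0 < t → HasDerivAt p ((-(1 + α) * p t + t - p t ^ 2) / t) t) (k : ℕ) :
    IsSymbol k (-1) fun t =>
      p t - threeTerm 1 ((2 * α + 3) / 4) ((4 * (α + 1) ^ 2 - 1) / 32) t := by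
  have hpos : ∀ᶠ t : ℝ in atTop, 0 < t := eventually_gt_atTop 0
  set A := (2 * α + 3) / 4 with hA
  set c := (4 * (α + 1) ^ 2 - 1) / 32 with hc
  set e := threeTerm 1 A c with he
  let r : ℝ → ℝ := fun t => p t - e t
  let b : ℝ → ℝ := fun t => -(1 + α) - 2 * e t - r t
  -- `g` is the defect of the ansatz `e` in the Riccati equation; `A` and `c` are the values that
  -- cancel its terms of order `√t` and `1`.
  let g : ℝ → ℝ := fun t => -c * t ^ (-1 / 2 : ℝ) - c ^ 2 * t ^ (-1 : ℝ)
  let e' : ℝ → ℝ := fun t => -(1 / 2) * t ^ (1 / 2 : ℝ) + c / 2 * t ^ (-1 / 2 : ℝ)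
  have he' : ∀ t, 0 < t → HasDerivAt e (e' t / t) t := fun t ht => hasDerivAt_threeTerm 1 A c ht
  have hes : ∀ k, IsSymbol k (1 / 2) e := fun k => isSymbol_threeTerm k 1 A c
  have hes' : ∀ k, IsSymbol k (1 / 2) e' := fun k =>
    ((IsSymbol.rpow k (1 / 2)).const_mul _).add
      (((IsSymbol.rpow k (-1 / 2)).mono (by norm_num)).const_mul _)
  have hg : ∀ k, IsSymbol k (-1 / 2) g := fun k =>
    ((IsSymbol.rpow k (-1 / 2)).const_mul _).sub
      (((IsSymbol.rpow k (-1)).mono (by norm_num)).const_mul _)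
  have hr : ∀ t, 0 < t → HasDerivAt r ((b t * r t + g t) / t) t := by
    intro t ht
    refine ((hd t ht).sub (he' t ht)).congr_deriv ?_
    have h1 := rpow_half_mul_rpow_neg_half ht
    have h2 := rpow_half_mul_self ht
    have h3 : t ^ (-1 : ℝ) = t ^ (-1 / 2 : ℝ) * t ^ (-1 / 2 : ℝ) := by
      rw [← Real.rpow_add ht]; norm_num
    rw [← sub_div]
    congr 1
    simp only [b, r, g, e', he, threeTerm, h3, hA, hc]
    linear_combination (-2 * ((4 * (α + 1) ^ 2 - 1) / 32)) * h1 - h2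
  have hr0 : IsSymbol 0 0 r :=
    (hp.add ((IsSymbol.const 0 A).add (((IsSymbol.rpow 0 (-1 / 2)).const_mul c).mono
      (by norm_num)))).congr (Eventually.of_forall fun t => by
        simp only [r, he, threeTerm]; ring)
  have hdiff : ∀ {k : ℕ} {r : ℝ → ℝ}, IsSymbol k 0 r →
      IsSymbol k 0 fun t => -(1 + α) - 2 * e t - r t - 2 * t ^ (1 / 2 : ℝ) := by
    intro k r hr
    refine (((IsSymbol.const k (-(1 + α) + 2 * A)).sub hr).add
      (((IsSymbol.rpow k (-1 / 2)).const_mul (2 * c)).mono (by norm_num))).congr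
        (Eventually.of_forall fun t => ?_)
    simp only [he, threeTerm]
    ring
  have hlow : ∀ {r : ℝ → ℝ}, IsSymbol 0 0 r →
      ∀ᶠ t : ℝ in atTop, 1 * t ^ (1 / 2 : ℝ) ≤ -(1 + α) - 2 * e t - r t := by
    intro r hr
    filter_upwards [(hdiff hr).eventually_abs_le (l := 1 / 2) (by norm_num) one_pos] with t ht
    linarith [neg_le_of_abs_le ht]
  have hbs : ∀ {k : ℕ} {r : ℝ → ℝ}, IsSymbol k 0 r →
      IsSymbol k (1 / 2) fun t => -(1 + α) - 2 * e t - r t := fun {k} {r} hr =>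
    ((((IsSymbol.const k (-(1 + α))).mono (by norm_num)).sub ((hes k).const_mul 2)).sub
      (hr.mono (by norm_num)))
  induction k with
  | zero =>
    exact isBigO_of_linear_ode one_pos (hlow hr0) (hg 0).isBigO hr0.isBigO
      (hpos.mono fun t ht => hr t ht)
  | succ k ih =>
    change IsSymbol k (-1) r at ih
    refine ⟨ih.isBigO, fun t => b t * r t + g t, hpos.mono fun t ht => hr t ht, ?_⟩
    have hrk : IsSymbol k 0 r := ih.mono (by norm_num)
    have h2r : IsSymbol k 0 fun t => 2 * r t := hrk.const_mul 2
    have hv := ((hbs hrk).mul ih).add ((hg k).mono (by norm_num))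
    have hG := (((hes' k).mul ih).const_mul (-2)).mono (l := -1 / 2) (by norm_num) |>.add
      (((IsSymbol.rpow k (-1 / 2)).const_mul (c / 2)).add
        (((IsSymbol.rpow k (-1)).const_mul (c ^ 2)).mono (by norm_num)))
    -- For `v = t r' = b r + g` one gets `t v' = b v + (t b') r + t g'` with `t b' = -2 e' - v`. The
    -- term `-v r` is moved into the coefficient, which becomes `b - r`; hence `2 r` in place of
    -- `r`.
    refine IsSymbol.of_linear_ode one_pos (hbs h2r)
      (hlow (((hr0.const_mul 2)))) hG hv.isBigO ?_
    filter_upwards [hpos] with t ht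
    have h1 : HasDerivAt b ((-2 * e' t - (b t * r t + g t)) / t) t :=
      ((((he' t ht).const_mul 2).const_sub _).sub (hr t ht)).congr_deriv (by ring)
    have h2 : HasDerivAt g ((c / 2 * t ^ (-1 / 2 : ℝ) + c ^ 2 * t ^ (-1 : ℝ)) / t) t :=
      (((hasDerivAt_rpow_div (-1 / 2) ht).const_mul (-c)).sub
        ((hasDerivAt_rpow_div (-1) ht).const_mul (c ^ 2))).congr_deriv (by ring)
    refine ((h1.mul (hr t ht)).add h2).congr_deriv ?_
    simp only [b]
    ring

/-- The expansion of the sub-leading coefficients, from the Toda-type system which they satisfy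
together with the recurrence coefficients `β n`. -/
theorem isSymbol_toda {α : ℝ} {p β : ℕ → ℝ → ℝ} (h0 : ∀ t, p 0 t = 0)
    (h1 : IsSymbol 0 0 fun t => p 1 t + t ^ (1 / 2 : ℝ))
    (hric : ∀ t, 0 < t → HasDerivAt (p 1) ((-(1 + α) * p 1 t + t - p 1 t ^ 2) / t) t)
    (hp : ∀ n t, 0 < t → HasDerivAt (p (n + 1)) ((p (n + 1) t + β (n + 1) t) / t) t)
    (hβ : ∀ n t, 0 < t → HasDerivAt (β (n + 1))
      (β (n + 1) t * (p (n + 2) t - 2 * p (n + 1) t + p n t + 2) / t) t) (n k : ℕ) :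
    IsSymbol k (-1) fun t => p n t - threeTerm n (n * (2 * α + 3 * n) / 4)
      (n * (4 * (α + n) ^ 2 - 1) / 32) t := by
  induction n using Nat.strong_induction_on generalizing k with
  | _ n ih =>
    match n, ih with
    | 0, _ =>
      refine ((IsSymbol.rpow k (-1)).const_mul 0).congr (Eventually.of_forall fun t => ?_)
      simp [threeTerm, h0]
    | 1, _ => simpa using isSymbol_riccati h1 hric k
    | n + 2, ih =>
      have hn : (0 : ℝ) < (n + 1 : ℕ) := by positivity
      have hσ := isSymbol_logDeriv_of_threeTerm hn (fun k => ih (n + 1) (by omega) k) (hp n)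
        (hβ n) k
      -- Solve the `β` equation for `p (n+2)`. The coefficients match because the second difference
      -- of `n (4 (α+n)² - 1) / 32` at `n + 1` is `(2 α + 3 (n+1)) / 4`, the ratio `A / N`, and that
      -- of `n (2 α + 3 n) / 4` is `3/2 = 2 - 1/2`.
      refine (((ih (n + 1) (by omega) k).const_mul 2).sub (ih n (by omega) k) |>.add hσ).congr ?_
      refine Eventually.of_forall fun t => ?_
      simp only [threeTerm]
      push_cast at hn ⊢
      field_simp
      ring

/-! ### The weight and its moments for `t > 0`. -/

theorem weight_measurable (α t : ℝ) : Measurable (weight α t) := by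
  unfold weight
  fun_prop

theorem pow_mul_weight {α t : ℝ} (j : ℕ) {x : ℝ} (hx : 0 < x) :
    x ^ j * weight α t x = weight (α + j) t x := by
  rw [weight, weight, Real.rpow_add hx, Real.rpow_natCast]
  ring

/-- For `t > 0` the factor `exp (-t/x)` beats every power of `x` at the origin, so `α` may be any
real number. This matters because `∂/∂t` lowers `α` by one, possibly below `-1`. -/
theorem integrableOn_weight (α : ℝ) {t : ℝ} (ht : 0 < t) : IntegrableOn (weight α t) (Ioi 0) := by
  obtain ⟨m, hm⟩ := exists_nat_gt (-1 - α)
  refine Integrable.mono' (((Real.GammaIntegral_convergent (s := α + m + 1)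
    (by linarith)).const_mul (m.factorial / t ^ m))) (weight_measurable α t).aestronglyMeasurable ?_
  refine (ae_restrict_iff' measurableSet_Ioi).2 (Eventually.of_forall fun x hx => ?_)
  have hx : 0 < x := hx
  rw [Real.norm_of_nonneg (weight_pos α t hx).le, add_sub_cancel_right, Real.rpow_add hx,
    Real.rpow_natCast, weight, sub_eq_add_neg, Real.exp_add, Real.exp_neg (t / x)]
  have h1 := Real.pow_div_factorial_le_exp (t / x) (by positivity) m
  have h2 : (Real.exp (t / x))⁻¹ ≤ m.factorial / t ^ m * x ^ m := by
    calc (Real.exp (t / x))⁻¹ ≤ ((t / x) ^ m / m.factorial)⁻¹ := by gcongr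
      _ = m.factorial / t ^ m * x ^ m := by rw [div_pow]; field_simp
  have h3 := Real.rpow_pos_of_pos hx α
  calc x ^ α * (Real.exp (-x) * (Real.exp (t / x))⁻¹)
      ≤ x ^ α * (Real.exp (-x) * (m.factorial / t ^ m * x ^ m)) := by gcongr
    _ = _ := by ring

theorem integrableOn_pow_mul_weight (α : ℝ) {t : ℝ} (ht : 0 < t) (j : ℕ) :
    IntegrableOn (fun x => x ^ j * weight α t x) (Ioi 0) :=
  (integrableOn_weight (α + j) ht).congr_fun (fun _ hx => (pow_mul_weight j hx).symm)
    measurableSet_Ioi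

theorem moment_succ_sub_one (α t : ℝ) (j : ℕ) : moment (α - 1) t (j + 1) = moment α t j := by
  refine setIntegral_congr_fun measurableSet_Ioi fun x (hx : 0 < x) => ?_
  simp only [pow_mul_weight _ hx]
  congr 1
  push_cast
  ring

theorem hasDerivAt_weight_param (α t : ℝ) {x : ℝ} (hx : 0 < x) :
    HasDerivAt (fun t => weight α t x) (-weight (α - 1) t x) t := by
  have h := ((((hasDerivAt_id t).div_const x).const_sub (-x)).exp).const_mul (x ^ α)
  refine h.congr_deriv ?_
  rw [weight, Real.rpow_sub_one hx.ne']
  simp only [id]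
  ring

theorem hasDerivAt_moment (α : ℝ) {t : ℝ} (ht : 0 < t) (j : ℕ) :
    HasDerivAt (fun t => moment α t j) (-moment (α - 1) t j) t := by
  have h := hasDerivAt_integral_of_dominated_loc_of_deriv_le (μ := volume.restrict (Ioi 0))
    (F := fun t x => x ^ j * weight α t x) (F' := fun t x => -(x ^ j * weight (α - 1) t x))
    -- The weight decreases in `t`, so its value at `t / 2` dominates a whole neighbourhood of `t`.
    (x₀ := t) (s := Ioi (t / 2)) (bound := fun x => x ^ j * weight (α - 1) (t / 2) x)
    (Ioi_mem_nhds (by linarith))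
    (Eventually.of_forall fun s =>
      ((measurable_id.pow_const j).mul (weight_measurable α s)).aestronglyMeasurable)
    (integrableOn_pow_mul_weight α ht j)
    ((measurable_id.pow_const j).mul (weight_measurable (α - 1) t)).neg.aestronglyMeasurable
    ?_ (integrableOn_pow_mul_weight (α - 1) (half_pos ht) j) ?_
  · have h2 := h.2
    rw [integral_neg] at h2
    exact h2
  · refine (ae_restrict_iff' measurableSet_Ioi).2 (Eventually.of_forall fun x hx s hs => ?_)
    have hx : 0 < x := hx
    have hs : t / 2 < s := hs
    rw [norm_neg, Real.norm_of_nonneg (mul_nonneg (pow_nonneg hx.le _) (weight_pos _ _ hx).le)]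
    unfold weight
    have := Real.rpow_pos_of_pos hx (α - 1)
    gcongr
  · refine (ae_restrict_iff' measurableSet_Ioi).2 (Eventually.of_forall fun x hx s _ => ?_)
    exact ((hasDerivAt_weight_param α s hx).const_mul (x ^ j)).congr_deriv (by ring)

theorem hasDerivAt_weight (α t : ℝ) {x : ℝ} (hx : 0 < x) :
    HasDerivAt (weight α t) (α * weight (α - 1) t x - weight α t x + t * weight (α - 2) t x) x := by
  have h1 := Real.hasDerivAt_rpow_const (p := α) (Or.inl hx.ne')
  have h2 := ((hasDerivAt_neg x).sub ((hasDerivAt_inv hx.ne').const_mul t)).exp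
  refine ((h1.mul h2).congr_deriv ?_).congr_of_eventuallyEq (Eventually.of_forall fun y => ?_)
  · simp only [weight, Real.rpow_sub_one hx.ne', show α - 2 = α - 1 - 1 by ring, Pi.sub_apply]
    field_simp
    ring
  · simp [weight, div_eq_mul_inv]

/-- The recurrence for the moments, from integrating the derivative of `x ^ (j + 1) * weight`. -/
theorem moment_recurrence {α : ℝ} (hα : -1 < α) {t : ℝ} (ht : 0 < t) (j : ℕ) :
    (j + 1 + α) * moment α t j - moment α t (j + 1) + t * moment (α - 1) t j = 0 := by
  have hs : 0 < α + (j + 1) := by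
    have : (0 : ℝ) ≤ j := Nat.cast_nonneg j
    linarith
  set f' : ℝ → ℝ := fun x =>
    (j + 1 + α) * (x ^ j * weight α t x) - x ^ (j + 1) * weight α t x +
      t * (x ^ j * weight (α - 1) t x) with hf'
  have hder : ∀ x ∈ Ioi (0 : ℝ), HasDerivAt (fun x => x ^ (j + 1) * weight α t x) (f' x) x := by
    intro x hx
    have hx : 0 < x := hx
    refine ((hasDerivAt_pow (j + 1) x).mul (hasDerivAt_weight α t hx)).congr_deriv ?_
    simp only [hf', weight, Real.rpow_sub_one hx.ne', show α - 2 = α - 1 - 1 by ring]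
    push_cast
    field_simp
    ring
  have hint : IntegrableOn f' (Ioi 0) :=
    (((integrableOn_pow_mul_weight α ht j).const_mul _).sub
      (integrableOn_pow_mul_weight α ht (j + 1))).add
        ((integrableOn_pow_mul_weight (α - 1) ht j).const_mul t)
  have hcont : ContinuousWithinAt (fun x => x ^ (j + 1) * weight α t x) (Ici 0) 0 := by
    rw [ContinuousWithinAt]
    simp only [ne_eq, Nat.add_eq_zero_iff, one_ne_zero, and_false, not_false_eq_true, zero_pow,
      zero_mul]
    have hlim : Tendsto (fun x : ℝ => x ^ (α + (j + 1))) (nhdsWithin 0 (Ici 0)) (nhds 0) := by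
      have := (Real.continuousAt_rpow_const 0 (α + (j + 1)) (Or.inr hs.le)).tendsto
      rw [Real.zero_rpow hs.ne'] at this
      exact this.mono_left nhdsWithin_le_nhds
    refine squeeze_zero' ?_ ?_ hlim
    · filter_upwards [self_mem_nhdsWithin] with x hx
      have hx : 0 ≤ x := hx
      unfold weight
      positivity
    · filter_upwards [self_mem_nhdsWithin] with x hx
      rcases eq_or_lt_of_le (show (0 : ℝ) ≤ x from hx) with h | h
      · rw [← h, Real.zero_rpow hs.ne']
        simp
      · rw [pow_mul_weight _ h, weight]
        push_cast
        refine mul_le_of_le_one_right (Real.rpow_nonneg h.le _) (Real.exp_le_one_iff.2 ?_)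
        have : 0 ≤ t / x := by positivity
        linarith
  have hlim := tendsto_zero_of_hasDerivAt_of_integrableOn_Ioi hder hint
    (integrableOn_pow_mul_weight α ht (j + 1))
  have key := integral_Ioi_of_hasDerivAt_of_tendsto hcont hder hint hlim
  have hsplit : ∫ x in Ioi 0, f' x =
      (j + 1 + α) * moment α t j - moment α t (j + 1) + t * moment (α - 1) t j := by
    have hsub : IntegrableOn (fun x => (j + 1 + α) * (x ^ j * weight α t x) -
        x ^ (j + 1) * weight α t x) (Ioi 0) :=
      ((integrableOn_pow_mul_weight α ht j).const_mul _).sub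
        (integrableOn_pow_mul_weight α ht (j + 1))
    simp only [hf']
    rw [integral_add hsub ((integrableOn_pow_mul_weight (α - 1) ht j).const_mul t),
      integral_sub ((integrableOn_pow_mul_weight α ht j).const_mul _)
        (integrableOn_pow_mul_weight α ht (j + 1)), integral_const_mul, integral_const_mul]
    rfl
  rw [← hsplit, key]
  simp

/-! ### The moment functional and integration by parts. -/

/-- The functional `p ↦ ∫_0^∞ p(x) w(x; t, α) dx`. -/
noncomputable def functional (α t : ℝ) (p : ℝ[X]) : ℝ :=
  p.sum fun i a => a * moment α t i

theorem functional_eq_sum_range (α t : ℝ) {p : ℝ[X]} {N : ℕ} (hN : p.natDegree < N) :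
    functional α t p = ∑ i ∈ Finset.range N, p.coeff i * moment α t i :=
  sum_over_range' p (fun _ => by simp) N hN

theorem functional_add (α t : ℝ) (p q : ℝ[X]) :
    functional α t (p + q) = functional α t p + functional α t q :=
  sum_add_index _ _ _ (fun _ => by simp) (fun _ _ _ => by ring)

theorem functional_monomial (α t : ℝ) (i : ℕ) (a : ℝ) :
    functional α t (monomial i a) = a * moment α t i :=
  sum_monomial_index _ _ (by simp)

theorem functional_C_mul (α t c : ℝ) (p : ℝ[X]) :
    functional α t (C c * p) = c * functional α t p := by
  induction p using Polynomial.induction_on' with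
  | add p q hp hq => rw [mul_add, functional_add, functional_add, hp, hq, mul_add]
  | monomial n a => rw [C_mul_monomial, functional_monomial, functional_monomial, mul_assoc]

theorem functional_sub (α t : ℝ) (p q : ℝ[X]) :
    functional α t (p - q) = functional α t p - functional α t q := by
  have := functional_C_mul α t (-1) q
  rw [sub_eq_add_neg, functional_add]
  simp only [C_neg, C_1, neg_mul, one_mul] at this
  rw [this, sub_eq_add_neg]

theorem functional_eq_integral (α : ℝ) {t : ℝ} (ht : 0 < t) (p : ℝ[X]) :
    functional α t p = ∫ x in Ioi (0 : ℝ), p.eval x * weight α t x := by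
  have h : ∀ x, p.eval x * weight α t x = ∑ i ∈ Finset.range (p.natDegree + 1),
      p.coeff i * (x ^ i * weight α t x) := fun x => by
    rw [eval_eq_sum_range, Finset.sum_mul]
    exact Finset.sum_congr rfl fun i _ => by ring
  simp only [h]
  rw [integral_finsetSum _ fun i _ => (integrableOn_pow_mul_weight α ht i).const_mul _,
    functional_eq_sum_range α t (Nat.lt_succ_self _)]
  exact Finset.sum_congr rfl fun i _ => (integral_const_mul _ _).symm

theorem pairing_eq_functional (α : ℝ) {t : ℝ} (ht : 0 < t) (p q : ℝ[X]) :
    pairing α t p q = functional α t (p * q) := by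
  rw [functional_eq_integral α ht, pairing]
  simp only [eval_mul]

/-- Integration by parts against the weight. -/
theorem functional_by_parts {α : ℝ} (hα : -1 < α) {t : ℝ} (ht : 0 < t) (p : ℝ[X]) :
    functional α t (X * derivative p) + (1 + α) * functional α t p - functional α t (X * p) +
      t * functional (α - 1) t p = 0 := by
  induction p using Polynomial.induction_on' with
  | add p q hp hq =>
    simp only [derivative_add, mul_add, functional_add]
    linear_combination hp + hq
  | monomial n a =>
    have h1 : X * derivative (monomial n a) = C (n : ℝ) * monomial n a := by
      rw [derivative_monomial, X_mul_monomial, C_mul_monomial]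
      rcases n with _ | n
      · simp
      · simp [mul_comm]
    rw [h1, functional_C_mul, X_mul_monomial]
    simp only [functional_monomial]
    linear_combination a * moment_recurrence hα ht n

/-! ### Differentiation of polynomial families in `t`. -/

/-- Coefficientwise derivative of a family of polynomials of bounded degree. -/
def HasPolyDerivAt (Q : ℝ → ℝ[X]) (Q' : ℝ[X]) (t : ℝ) : Prop :=
  (∃ N : ℕ, ∀ s, (Q s).natDegree < N) ∧ ∀ i, HasDerivAt (fun s => (Q s).coeff i) (Q'.coeff i) t

namespace HasPolyDerivAt

variable {P Q : ℝ → ℝ[X]} {P' Q' : ℝ[X]} {t : ℝ}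

theorem const (P : ℝ[X]) (t : ℝ) : HasPolyDerivAt (fun _ => P) 0 t :=
  ⟨⟨_, fun _ => Nat.lt_succ_self _⟩, fun i => by simpa using hasDerivAt_const t (P.coeff i)⟩

theorem C {f : ℝ → ℝ} {f' : ℝ} (hf : HasDerivAt f f' t) :
    HasPolyDerivAt (fun s => Polynomial.C (f s)) (Polynomial.C f') t := by
  refine ⟨⟨1, fun s => by simp⟩, fun i => ?_⟩
  simp only [coeff_C]
  split_ifs
  · exact hf
  · exact hasDerivAt_const t 0

theorem sub (hP : HasPolyDerivAt P P' t) (hQ : HasPolyDerivAt Q Q' t) :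
    HasPolyDerivAt (fun s => P s - Q s) (P' - Q') t := by
  obtain ⟨⟨N, hN⟩, hP⟩ := hP
  obtain ⟨⟨M, hM⟩, hQ⟩ := hQ
  refine ⟨⟨max N M, fun s => (natDegree_sub_le _ _).trans_lt (max_lt_max (hN s) (hM s))⟩,
    fun i => ?_⟩
  simp only [coeff_sub]
  exact (hP i).sub (hQ i)

theorem mul (hP : HasPolyDerivAt P P' t) (hQ : HasPolyDerivAt Q Q' t) :
    HasPolyDerivAt (fun s => P s * Q s) (P' * Q t + P t * Q') t := by
  obtain ⟨⟨N, hN⟩, hP⟩ := hP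
  obtain ⟨⟨M, hM⟩, hQ⟩ := hQ
  refine ⟨⟨N + M, fun s => natDegree_mul_le.trans_lt (add_lt_add (hN s) (hM s))⟩, fun i => ?_⟩
  simp only [coeff_add, coeff_mul, ← Finset.sum_add_distrib]
  exact HasDerivAt.fun_sum fun x _ => (hP x.1).mul (hQ x.2)

theorem sum {ι : Type*} (s : Finset ι) {P : ι → ℝ → ℝ[X]} {P' : ι → ℝ[X]}
    (h : ∀ i ∈ s, HasPolyDerivAt (P i) (P' i) t) :
    HasPolyDerivAt (fun u => ∑ i ∈ s, P i u) (∑ i ∈ s, P' i) t := by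
  classical
  choose! N hN using fun i hi => (h i hi).1
  refine ⟨⟨s.sup N + 1, fun u => Nat.lt_succ_of_le (natDegree_sum_le_of_forall_le _ _
    fun i hi => (hN i hi u).le.trans (Finset.le_sup hi))⟩, fun j => ?_⟩
  simp only [finsetSum_coeff]
  exact HasDerivAt.fun_sum fun i hi => (h i hi).2 j

theorem natDegree_lt (hQ : HasPolyDerivAt Q Q' t) :
    ∃ N : ℕ, (∀ s, (Q s).natDegree < N) ∧ Q'.natDegree < N := by
  obtain ⟨⟨N, hN⟩, h⟩ := hQ
  refine ⟨N, hN, lt_of_not_ge fun hle => ?_⟩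
  have h1 := h Q'.natDegree
  simp only [fun s => coeff_eq_zero_of_natDegree_lt ((hN s).trans_le hle)] at h1
  have h2 : Q' = 0 := leadingCoeff_eq_zero.1 (h1.unique (hasDerivAt_const t 0))
  have h3 := (hN t).trans_le hle
  simp [h2] at h3

end HasPolyDerivAt

/-- Product rule: the moments contribute the functional at `α - 1`, since `∂w/∂t = -w/x`. -/
theorem HasPolyDerivAt.functional {Q : ℝ → ℝ[X]} {Q' : ℝ[X]} (α : ℝ) {t : ℝ} (ht : 0 < t)
    (hQ : HasPolyDerivAt Q Q' t) :
    HasDerivAt (fun s => functional α s (Q s))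
      (SingularLaguerre.functional α t Q' - SingularLaguerre.functional (α - 1) t (Q t)) t := by
  obtain ⟨N, hN, hN'⟩ := hQ.natDegree_lt
  simp only [functional_eq_sum_range _ _ (hN _), functional_eq_sum_range _ _ hN',
    ← Finset.sum_sub_distrib]
  exact HasDerivAt.fun_sum fun i _ => ((hQ.2 i).mul (hasDerivAt_moment α ht i)).congr_deriv
    (by ring)

/-! ### Orthogonality relations and the Toda-type system. -/

/-- The squared norm `h_n(t)` of the monic orthogonal polynomial of degree `n`. -/
noncomputable def sqNorm (α : ℝ) (n : ℕ) (t : ℝ) : ℝ :=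
  functional α t (monicOP α t n * monicOP α t n)

theorem sqNorm_pos {α : ℝ} (hα : -1 < α) (n : ℕ) {t : ℝ} (ht : 0 < t) : 0 < sqNorm α n t := by
  rw [sqNorm, ← pairing_eq_functional α ht]
  exact (monicOP_isMonicOrthogonal hα ht.le).norm_pos n

theorem natDegree_monicOP (α t : ℝ) (n : ℕ) : (monicOP α t n).natDegree = n :=
  natDegree_eq_of_degree_eq_some (monicOP_monic_degree α t n).2

theorem coeff_monicOP_self (α t : ℝ) (n : ℕ) : (monicOP α t n).coeff n = 1 := by
  have := (monicOP_monic_degree α t n).1.coeff_natDegree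
  rwa [natDegree_monicOP] at this

theorem coeff_monicOP_of_lt (α t : ℝ) {n i : ℕ} (h : n < i) : (monicOP α t n).coeff i = 0 :=
  coeff_eq_zero_of_natDegree_lt (by rwa [natDegree_monicOP])

theorem coeff_X_mul_monicOP (α t : ℝ) (n : ℕ) :
    (X * monicOP α t n).coeff n = subleading α n t := by
  cases n with
  | zero => simp [subleading]
  | succ n => rw [coeff_X_mul]; rfl

theorem functional_monicOP_mul_monicOP {α : ℝ} (hα : -1 < α) {t : ℝ} (ht : 0 < t) {m n : ℕ}
    (h : m ≠ n) : functional α t (monicOP α t m * monicOP α t n) = 0 := by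
  rw [← pairing_eq_functional α ht]
  exact (monicOP_isMonicOrthogonal hα ht.le).orthogonal m n h

/-- Pairing a polynomial of degree at most `n` with `P_n` reads off its coefficient of `x ^ n`. -/
theorem functional_mul_monicOP {α : ℝ} (hα : -1 < α) {t : ℝ} (ht : 0 < t) {n : ℕ} {q : ℝ[X]}
    (hq : ∀ i, n < i → q.coeff i = 0) :
    functional α t (q * monicOP α t n) = q.coeff n * sqNorm α n t := by
  have hP := monicOP_isMonicOrthogonal hα ht.le
  have h : pairing α t (q - C (q.coeff n) * monicOP α t n) (monicOP α t n) = 0 := by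
    refine pairing_eq_zero_of_degree_lt hα ht.le hP (fun k hk => hP.orthogonal k n hk.ne) _ ?_
    rw [degree_lt_iff_coeff_zero]
    intro i hi
    rcases eq_or_lt_of_le hi with h | h
    · subst h
      simp [coeff_monicOP_self]
    · simp [hq i h, coeff_monicOP_of_lt α t h]
  rw [pairing_eq_functional α ht, sub_mul, functional_sub, mul_assoc, functional_C_mul,
    sub_eq_zero] at h
  exact h

theorem functional_X_mul_monicOP_sq {α : ℝ} (hα : -1 < α) {t : ℝ} (ht : 0 < t) (n : ℕ) :
    functional α t (X * (monicOP α t n * monicOP α t n)) =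
      (subleading α n t - subleading α (n + 1) t) * sqNorm α n t := by
  have h := functional_mul_monicOP hα ht (n := n) (q := X * monicOP α t n - monicOP α t (n + 1))
    (fun i hi => by
      obtain ⟨j, rfl⟩ : ∃ j, i = j + 1 := ⟨i - 1, by omega⟩
      rw [coeff_sub, coeff_X_mul]
      rcases eq_or_lt_of_le (Nat.le_of_lt_succ hi) with h | h
      · subst h
        simp [coeff_monicOP_self]
      · simp [coeff_monicOP_of_lt α t h, coeff_monicOP_of_lt α t (Nat.succ_lt_succ h)])
  rw [sub_mul, functional_sub, functional_monicOP_mul_monicOP hα ht (Nat.succ_ne_self n), sub_zero,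
    coeff_sub, coeff_X_mul_monicOP, mul_assoc] at h
  exact h

theorem coeff_X_mul_derivative (p : ℝ[X]) (i : ℕ) :
    (X * derivative p).coeff i = i * p.coeff i := by
  cases i with
  | zero => simp
  | succ i => rw [coeff_X_mul, coeff_derivative]; push_cast; ring

theorem functional_X_mul_derivative_monicOP_mul {α : ℝ} (hα : -1 < α) {t : ℝ} (ht : 0 < t)
    (n : ℕ) : functional α t (X * derivative (monicOP α t n) * monicOP α t n) =
      n * sqNorm α n t := by
  rw [functional_mul_monicOP hα ht, coeff_X_mul_derivative, coeff_monicOP_self, mul_one]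
  intro i hi
  rw [coeff_X_mul_derivative, coeff_monicOP_of_lt α t hi, mul_zero]

/-- Differentiability passes through the Gram–Schmidt recursion because the denominators are
positive. No formula for the derivative is needed: monicity alone puts its degree below `n`. -/
theorem exists_hasPolyDerivAt_monicOP {α : ℝ} (hα : -1 < α) {t : ℝ} (ht : 0 < t) (n : ℕ) :
    ∃ P', HasPolyDerivAt (fun s => monicOP α s n) P' t := by
  induction n using Nat.strong_induction_on with
  | _ n ih =>
    choose! P' hP' using ih
    have hpair : ∀ (Q R : ℝ → ℝ[X]) (Q' R' : ℝ[X]), HasPolyDerivAt Q Q' t →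
        HasPolyDerivAt R R' t → ∃ d, HasDerivAt (fun s => pairing α s (Q s) (R s)) d t := by
      intro Q R Q' R' hQ hR
      refine ⟨_, ((hQ.mul hR).functional α ht).congr_of_eventuallyEq ?_⟩
      filter_upwards [lt_mem_nhds ht] with s hs
      exact pairing_eq_functional α hs _ _
    have hterm : ∀ k : Fin n, ∃ R', HasPolyDerivAt (fun s =>
        C (pairing α s (X ^ n) (monicOP α s k) /
          pairing α s (monicOP α s k) (monicOP α s k)) * monicOP α s k) R' t := by
      intro k
      have hk := hP' k k.isLt
      obtain ⟨d₁, h₁⟩ := hpair _ _ _ _ (HasPolyDerivAt.const (X ^ n) t) hk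
      obtain ⟨d₂, h₂⟩ := hpair _ _ _ _ hk hk
      exact ⟨_, (HasPolyDerivAt.C (h₁.div h₂
        ((monicOP_isMonicOrthogonal hα ht.le).norm_pos k).ne')).mul hk⟩
    choose R' hR' using hterm
    have h := (HasPolyDerivAt.const (X ^ n) t).sub
      (HasPolyDerivAt.sum Finset.univ fun k _ => hR' k)
    have e : (fun s => monicOP α s n) = fun s => X ^ n - ∑ k : Fin n,
        C (pairing α s (X ^ n) (monicOP α s k.val) /
          pairing α s (monicOP α s k.val) (monicOP α s k.val)) * monicOP α s k.val := by
      funext s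
      rw [monicOP]
    rw [e]
    exact ⟨_, h⟩

theorem HasPolyDerivAt.coeff_monicOP_eq_zero {α t : ℝ} {n : ℕ} {P' : ℝ[X]}
    (h : HasPolyDerivAt (fun s => monicOP α s n) P' t) {i : ℕ} (hi : n ≤ i) : P'.coeff i = 0 := by
  have h1 := h.2 i
  rcases eq_or_lt_of_le hi with hni | hni
  · subst hni
    simp only [coeff_monicOP_self] at h1
    exact h1.unique (hasDerivAt_const t 1)
  · simp only [fun s => coeff_monicOP_of_lt α s hni] at h1
    exact h1.unique (hasDerivAt_const t 0)

/-- Since `P_n'` is orthogonal to `P_n`, only `-∫ P_n² w / x` remains, and integration by parts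
applied to `P_n²` evaluates it. -/
theorem hasDerivAt_sqNorm {α : ℝ} (hα : -1 < α) (n : ℕ) {t : ℝ} (ht : 0 < t) :
    HasDerivAt (sqNorm α n) (sqNorm α n t *
      (subleading α (n + 1) t - subleading α n t + 2 * n + 1 + α) / t) t := by
  obtain ⟨P', hP'⟩ := exists_hasPolyDerivAt_monicOP hα ht n
  refine ((hP'.mul hP').functional α ht).congr_deriv ?_
  have h1 : functional α t (P' * monicOP α t n) = 0 := by
    rw [functional_mul_monicOP hα ht fun i hi => hP'.coeff_monicOP_eq_zero hi.le,
      hP'.coeff_monicOP_eq_zero le_rfl, zero_mul]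
  have h2 := functional_by_parts hα ht (monicOP α t n * monicOP α t n)
  rw [functional_X_mul_monicOP_sq hα ht, derivative_mul,
    mul_comm (monicOP α t n) (derivative _), mul_add, ← mul_assoc, functional_add,
    functional_X_mul_derivative_monicOP_mul hα ht] at h2
  rw [functional_add, mul_comm (monicOP α t n) P', h1, eq_div_iff ht.ne']
  change _ + (1 + α) * sqNorm α n t - _ + _ = 0 at h2
  linear_combination -h2

/-- Differentiate `∫ P_{n+1} P_n w = 0`: the `P_{n+1}'` term gives `p'` times `h n`, and integration
by parts evaluates the remaining integral against `w / x`. -/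
theorem hasDerivAt_subleading {α : ℝ} (hα : -1 < α) (n : ℕ) {t : ℝ} (ht : 0 < t) :
    HasDerivAt (subleading α (n + 1))
      ((subleading α (n + 1) t + sqNorm α (n + 1) t / sqNorm α n t) / t) t := by
  obtain ⟨P', hP'⟩ := exists_hasPolyDerivAt_monicOP hα ht (n + 1)
  obtain ⟨Q', hQ'⟩ := exists_hasPolyDerivAt_monicOP hα ht n
  refine (hP'.2 n).congr_deriv ?_
  have hne := (sqNorm_pos hα n ht).ne'
  have h1 : functional α t (P' * monicOP α t n) = P'.coeff n * sqNorm α n t :=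
    functional_mul_monicOP hα ht fun i hi => hP'.coeff_monicOP_eq_zero hi
  have h2 : functional α t (monicOP α t (n + 1) * Q') = 0 := by
    rw [mul_comm, functional_mul_monicOP hα ht fun i hi =>
      hQ'.coeff_monicOP_eq_zero (Nat.lt_of_succ_lt hi).le,
      hQ'.coeff_monicOP_eq_zero n.le_succ, zero_mul]
  have h4 : functional α t (P' * monicOP α t n + monicOP α t (n + 1) * Q') -
      functional (α - 1) t (monicOP α t (n + 1) * monicOP α t n) = 0 := by
    refine ((hP'.mul hQ').functional α ht).unique ((hasDerivAt_const t 0).congr_of_eventuallyEq ?_)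
    filter_upwards [lt_mem_nhds ht] with s hs
    exact functional_monicOP_mul_monicOP hα hs (Nat.succ_ne_self n)
  have h5 := functional_by_parts hα ht (monicOP α t (n + 1) * monicOP α t n)
  have h6 : functional α t (X * derivative (monicOP α t (n + 1)) * monicOP α t n) =
      -subleading α (n + 1) t * sqNorm α n t := by
    have h := functional_mul_monicOP hα ht (n := n)
      (q := X * derivative (monicOP α t (n + 1)) - C ((n : ℝ) + 1) * monicOP α t (n + 1))
      (fun i hi => by
        rw [coeff_sub, coeff_X_mul_derivative, coeff_C_mul]
        rcases eq_or_lt_of_le (Nat.succ_le_of_lt hi) with h | h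
        · subst h
          push_cast
          ring
        · rw [coeff_monicOP_of_lt α t h, mul_zero, mul_zero, sub_zero])
    rw [sub_mul, functional_sub, mul_assoc (C _), functional_C_mul,
      functional_monicOP_mul_monicOP hα ht (Nat.succ_ne_self n), coeff_sub, coeff_X_mul_derivative,
      coeff_C_mul] at h
    change _ = (n * subleading α (n + 1) t - (n + 1) * subleading α (n + 1) t) * _ at h
    linear_combination h
  have h7 : functional α t (X * derivative (monicOP α t n) * monicOP α t (n + 1)) = 0 := by
    have hz : ∀ i, n < i → (X * derivative (monicOP α t n)).coeff i = 0 := fun i hi => by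
      rw [coeff_X_mul_derivative, coeff_monicOP_of_lt α t hi, mul_zero]
    rw [functional_mul_monicOP hα ht fun i hi => hz i (Nat.lt_of_succ_lt hi), hz _ n.lt_succ_self,
      zero_mul]
  have h8 : functional α t (X * monicOP α t n * monicOP α t (n + 1)) = sqNorm α (n + 1) t := by
    rw [functional_mul_monicOP hα ht, coeff_X_mul, coeff_monicOP_self, one_mul]
    intro i hi
    obtain ⟨j, rfl⟩ : ∃ j, i = j + 1 := ⟨i - 1, by omega⟩
    rw [coeff_X_mul, coeff_monicOP_of_lt α t (Nat.lt_of_succ_lt_succ hi)]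
  have e1 : X * derivative (monicOP α t (n + 1) * monicOP α t n) =
      X * derivative (monicOP α t (n + 1)) * monicOP α t n +
        X * derivative (monicOP α t n) * monicOP α t (n + 1) := by
    rw [derivative_mul]; ring
  have e2 : X * (monicOP α t (n + 1) * monicOP α t n) =
      X * monicOP α t n * monicOP α t (n + 1) := by ring
  rw [e1, e2, functional_add, h6, h7, h8,
    functional_monicOP_mul_monicOP hα ht (Nat.succ_ne_self n)] at h5
  rw [functional_add, h1, h2] at h4
  rw [eq_div_iff ht.ne', ← sub_eq_iff_eq_add', eq_div_iff hne]
  linear_combination t * h4 + h5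

/-! ### The Hankel determinant and its logarithmic derivative. -/

theorem functional_sum (α t : ℝ) {ι : Type*} (s : Finset ι) (p : ι → ℝ[X]) :
    functional α t (∑ i ∈ s, p i) = ∑ i ∈ s, functional α t (p i) := by
  classical
  induction s using Finset.induction_on with
  | empty => simp [functional]
  | insert a s ha ih => rw [Finset.sum_insert ha, functional_add, ih, Finset.sum_insert ha]

theorem functional_mul_eq_sum (α t : ℝ) {n : ℕ} {p q : ℝ[X]} (hp : p.natDegree < n)
    (hq : q.natDegree < n) : functional α t (p * q) =
      ∑ j : Fin n, (∑ i : Fin n, p.coeff i * moment α t (i.val + j.val)) * q.coeff j := by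
  conv_lhs => rw [p.as_sum_range' n hp, q.as_sum_range' n hq]
  rw [Finset.sum_mul_sum]
  simp only [functional_sum, monomial_mul_monomial, functional_monomial,
    Finset.sum_mul, Finset.sum_range]
  rw [Finset.sum_comm]
  exact Finset.sum_congr rfl fun j _ => Finset.sum_congr rfl fun i _ => by ring

/-- The Hankel determinant is the product of the squared norms. -/
theorem hankelDet_eq_prod {α : ℝ} (hα : -1 < α) (n : ℕ) {t : ℝ} (ht : 0 < t) :
    hankelDet α n t = ∏ k ∈ Finset.range n, sqNorm α k t := by
  let T : Matrix (Fin n) (Fin n) ℝ := Matrix.of fun i j => (monicOP α t j).coeff i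
  let M : Matrix (Fin n) (Fin n) ℝ := Matrix.of fun i j => moment α t (i.val + j.val)
  have hT : T.det = 1 := Matrix.det_matrixOfPolynomials (fun j : Fin n => monicOP α t j)
    (fun j => natDegree_monicOP α t j) (fun j => (monicOP_monic_degree α t j).1)
  -- `T` is the change of basis from monomials to the `P_k`; it diagonalises the Gram matrix and has
  -- determinant one.
  have hTM : T.transpose * M * T = Matrix.diagonal fun k : Fin n => sqNorm α k t := by
    ext k l
    have h : (T.transpose * M * T) k l = functional α t (monicOP α t k * monicOP α t l) := by
      rw [functional_mul_eq_sum α t (n := n) (by rw [natDegree_monicOP]; exact k.isLt)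
        (by rw [natDegree_monicOP]; exact l.isLt)]
      simp only [Matrix.mul_apply, Matrix.transpose_apply, T, M, Matrix.of_apply]
    rw [h, Matrix.diagonal_apply]
    split_ifs with hkl
    · rw [hkl, sqNorm]
    · exact functional_monicOP_mul_monicOP hα ht fun hv => hkl (Fin.ext hv)
  have hdet := congrArg Matrix.det hTM
  rw [Matrix.det_mul, Matrix.det_mul, Matrix.det_transpose, hT, one_mul, mul_one,
    Matrix.det_diagonal, Fin.prod_univ_eq_prod_range (fun k => sqNorm α k t)] at hdet
  exact hdet

theorem hankelDet_pos {α : ℝ} (hα : -1 < α) (n : ℕ) {t : ℝ} (ht : 0 < t) :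
    0 < hankelDet α n t := by
  rw [hankelDet_eq_prod hα n ht]
  exact Finset.prod_pos fun k _ => sqNorm_pos hα k ht

theorem hasDerivAt_log_hankelDet {α : ℝ} (hα : -1 < α) (n : ℕ) {t : ℝ} (ht : 0 < t) :
    HasDerivAt (fun s => Real.log (hankelDet α n s))
      ((subleading α n t + n * (n + α)) / t) t := by
  have h : HasDerivAt (fun s => ∑ k ∈ Finset.range n, Real.log (sqNorm α k s))
      (∑ k ∈ Finset.range n, (sqNorm α k t *
        (subleading α (k + 1) t - subleading α k t + 2 * k + 1 + α) / t) / sqNorm α k t) t :=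
    HasDerivAt.fun_sum fun k _ => (hasDerivAt_sqNorm hα k ht).log (sqNorm_pos hα k ht).ne'
  refine (h.congr_deriv ?_).congr_of_eventuallyEq ?_
  · have hsum : ∀ n : ℕ, ∑ k ∈ Finset.range n,
        (subleading α (k + 1) t - subleading α k t + 2 * k + 1 + α) =
          subleading α n t + n * (n + α) := by
      intro n
      induction n with
      | zero => simp [subleading]
      | succ n ih => rw [Finset.sum_range_succ, ih]; push_cast; ring
    rw [← hsum, Finset.sum_div]
    refine Finset.sum_congr rfl fun k _ => ?_
    have := (sqNorm_pos hα k ht).ne'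
    field_simp
  · filter_upwards [lt_mem_nhds ht] with s hs
    rw [hankelDet_eq_prod hα n hs, Real.log_prod fun k _ => (sqNorm_pos hα k hs).ne']

theorem logDerivHankel_eq {α : ℝ} (hα : -1 < α) (n : ℕ) {t : ℝ} (ht : 0 < t) :
    logDerivHankel α n t = subleading α n t + n * (n + α) := by
  rw [logDerivHankel, (hasDerivAt_log_hankelDet hα n ht).deriv, mul_div_cancel₀ _ ht.ne']

/-! ### The case `n = 1`: Riccati equation and a priori bounds. -/

theorem monicOP_zero (α t : ℝ) : monicOP α t 0 = 1 := by
  rw [monicOP]; simp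

theorem monicOP_one (α t : ℝ) : monicOP α t 1 = X + C (subleading α 1 t) := by
  ext i
  rcases i with _ | _ | i
  · simp [subleading]
  · simp [coeff_monicOP_self]
  · rw [coeff_monicOP_of_lt α t (by omega)]
    simp [coeff_X]

theorem functional_X_pow (α t : ℝ) (i : ℕ) : functional α t (X ^ i) = moment α t i := by
  rw [X_pow_eq_monomial, functional_monomial, one_mul]

theorem sqNorm_zero (α t : ℝ) : sqNorm α 0 t = moment α t 0 := by
  rw [sqNorm, monicOP_zero, ← functional_X_pow, one_mul, pow_zero]

theorem moment_one_eq {α : ℝ} (hα : -1 < α) {t : ℝ} (ht : 0 < t) :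
    moment α t 1 = -subleading α 1 t * moment α t 0 := by
  have h := functional_monicOP_mul_monicOP hα ht (one_ne_zero (α := ℕ))
  have e : monicOP α t 1 * monicOP α t 0 = X ^ 1 + C (subleading α 1 t) * X ^ 0 := by
    rw [monicOP_zero, monicOP_one]; ring
  rw [e, functional_add, functional_C_mul, functional_X_pow, functional_X_pow] at h
  linarith

/-- The recurrence at `j = 1` involves only the moments of order 0, 1 and 2 at `α`, because the
first moment at `α - 1` is the zeroth at `α`. This closes the system at `n = 1`. -/
theorem sqNorm_one {α : ℝ} (hα : -1 < α) {t : ℝ} (ht : 0 < t) :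
    sqNorm α 1 t =
      (-(2 + α) * subleading α 1 t + t - subleading α 1 t ^ 2) * sqNorm α 0 t := by
  have h1 := moment_one_eq hα ht
  have h2 := moment_recurrence hα ht 1
  rw [show (1 : ℕ) = 0 + 1 from rfl, moment_succ_sub_one] at h2
  have e : monicOP α t 1 * monicOP α t 1 = X ^ 2 + C (subleading α 1 t) * X ^ 1 +
      C (subleading α 1 t) * (monicOP α t 1 * monicOP α t 0) := by
    rw [monicOP_zero, monicOP_one]; ring
  rw [sqNorm_zero, sqNorm, e, functional_add, functional_add, functional_C_mul, functional_C_mul,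
    functional_monicOP_mul_monicOP hα ht one_ne_zero, functional_X_pow, functional_X_pow]
  push_cast at h2
  norm_num at h2
  rw [h1] at h2 ⊢
  linear_combination -h2

theorem hasDerivAt_subleading_one {α : ℝ} (hα : -1 < α) {t : ℝ} (ht : 0 < t) :
    HasDerivAt (subleading α 1)
      ((-(1 + α) * subleading α 1 t + t - subleading α 1 t ^ 2) / t) t := by
  refine (hasDerivAt_subleading hα 0 ht).congr_deriv ?_
  rw [zero_add, sqNorm_one hα ht, mul_div_cancel_right₀ _ (sqNorm_pos hα 0 ht).ne']
  ring

/-- Expand `∫ (x - √t)² w / x ≥ 0` and eliminate `∫ w / x` by the moment recurrence; this yields `p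
≤ -√t - (1+α)/2`. -/
theorem subleading_one_le {α : ℝ} (hα : -1 < α) {t : ℝ} (ht : 0 < t) :
    subleading α 1 t ≤ -√t := by
  have hs := Real.sq_sqrt ht.le
  have h0 : 0 < moment α t 0 := sqNorm_zero α t ▸ sqNorm_pos hα 0 ht
  have hnn : 0 ≤ functional (α - 1) t ((X - C √t) * (X - C √t)) := by
    rw [functional_eq_integral _ ht]
    refine setIntegral_nonneg measurableSet_Ioi fun x hx => ?_
    rw [eval_mul]
    exact mul_nonneg (mul_self_nonneg _) (weight_pos _ _ hx).le
  have e : (X - C √t) * (X - C √t) = X ^ 2 - C (2 * √t) * X ^ 1 + C (√t ^ 2) * X ^ 0 := by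
    simp only [map_mul, map_pow, map_ofNat]; ring
  rw [e, functional_add, functional_sub, functional_C_mul, functional_C_mul, functional_X_pow,
    functional_X_pow, functional_X_pow, moment_succ_sub_one, moment_succ_sub_one α t 0, hs,
    moment_one_eq hα ht] at hnn
  have h2 := moment_recurrence hα ht 0
  rw [zero_add, moment_one_eq hα ht] at h2
  push_cast at h2
  have h3 : 0 ≤ (-(2 * subleading α 1 t) - 2 * √t - (1 + α)) * moment α t 0 := by linarith
  have h4 := nonneg_of_mul_nonneg_left h3 h0
  linarith

/-- Positivity of `h 1` says `p² + (2+α) p < t`, which fails below the stated bound. -/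
theorem le_subleading_one {α : ℝ} (hα : -1 < α) {t : ℝ} (ht : 0 < t) :
    -√t - (2 + α) ≤ subleading α 1 t := by
  have hs := Real.sq_sqrt ht.le
  have hs0 := Real.sqrt_nonneg t
  have h := sqNorm_pos hα 1 ht
  rw [sqNorm_one hα ht] at h
  have h1 := pos_of_mul_pos_left h (sqNorm_pos hα 0 ht).le
  by_contra! hlt
  nlinarith

theorem isSymbol_subleading_one_add {α : ℝ} (hα : -1 < α) :
    IsSymbol 0 0 fun t => subleading α 1 t + t ^ (1 / 2 : ℝ) := by
  refine IsBigO.of_bound (2 + α) ?_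
  filter_upwards [eventually_gt_atTop 0] with t ht
  rw [← Real.sqrt_eq_rpow, Real.rpow_zero, norm_one, mul_one, Real.norm_eq_abs, abs_le]
  constructor
  · linarith [le_subleading_one hα ht]
  · linarith [subleading_one_le hα ht]

/-! ### The expansions. -/

theorem isSymbol_subleading {α : ℝ} (hα : -1 < α) (n k : ℕ) :
    IsSymbol k (-1) fun t => subleading α n t - threeTerm n (n * (2 * α + 3 * n) / 4)
      (n * (4 * (α + n) ^ 2 - 1) / 32) t := by
  refine isSymbol_toda (p := subleading α)
    -- At `n = 0` the truncated `n - 1` makes this a junk value, but the system involves only `β (n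
    -- + 1)`.
    (β := fun n t => sqNorm α n t / sqNorm α (n - 1) t) (fun _ => rfl)
    (isSymbol_subleading_one_add hα) (fun t ht => hasDerivAt_subleading_one hα ht)
    (fun n t ht => hasDerivAt_subleading hα n ht) (fun n t ht => ?_) n k
  have h := (hasDerivAt_sqNorm hα (n + 1) ht).div (hasDerivAt_sqNorm hα n ht)
    (sqNorm_pos hα n ht).ne'
  refine h.congr_deriv ?_
  have := (sqNorm_pos hα n ht).ne'
  simp only [Nat.add_sub_cancel]
  push_cast
  field_simp
  ring

theorem isBigO_subleading {α : ℝ} (hα : -1 < α) (n : ℕ) :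
    (fun t : ℝ => subleading α n t - (-(n : ℝ) * √t - (n : ℝ) * (2 * α + 3 * (n : ℝ)) / 4
      - (n : ℝ) * (4 * (α + (n : ℝ)) ^ 2 - 1) / (32 * √t))) =O[atTop] fun t : ℝ => t⁻¹ := by
  refine (isSymbol_subleading hα n 0).isBigO.congr' ?_
    (Eventually.of_forall fun t => Real.rpow_neg_one t)
  filter_upwards [eventually_gt_atTop 0] with t ht
  have h : t ^ (-1 / 2 : ℝ) = (√t)⁻¹ := by
    rw [Real.sqrt_eq_rpow, ← Real.rpow_neg ht.le]; norm_num
  rw [threeTerm, h, ← Real.sqrt_eq_rpow]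
  have := (Real.sqrt_pos.2 ht).ne'
  field_simp

end SingularLaguerre

theorem mainTheorem9 (α : ℝ) (hα : -1 < α) (n : ℕ) :
    ((fun t : ℝ => SingularLaguerre.subleading α n t -
        (-(n : ℝ) * √t - (n : ℝ) * (2 * α + 3 * (n : ℝ)) / 4
          - (n : ℝ) * (4 * (α + (n : ℝ)) ^ 2 - 1) / (32 * √t)))
      =O[atTop] fun t : ℝ => t⁻¹) ∧
    (∀ t : ℝ, 0 < t → 0 < SingularLaguerre.hankelDet α n t ∧
      DifferentiableAt ℝ (fun s => Real.log (SingularLaguerre.hankelDet α n s)) t) ∧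
    ((fun t : ℝ => SingularLaguerre.logDerivHankel α n t -
        (-(n : ℝ) * √t + (n : ℝ) * (2 * α + (n : ℝ)) / 4
          - (n : ℝ) * (4 * (α + (n : ℝ)) ^ 2 - 1) / (32 * √t)))
      =O[atTop] fun t : ℝ => t⁻¹) := by
  have hO := SingularLaguerre.isBigO_subleading hα n
  refine ⟨hO, fun t ht => ⟨SingularLaguerre.hankelDet_pos hα n ht,
    (SingularLaguerre.hasDerivAt_log_hankelDet hα n ht).differentiableAt⟩, ?_⟩
  refine hO.congr' ?_ EventuallyEq.rfl
  filter_upwards [eventually_gt_atTop 0] with t ht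
  rw [SingularLaguerre.logDerivHankel_eq hα n ht]
  ring
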